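/- Let \(M\) be a quasiminimal structure: a one-sorted structure in a countable language whose universe is uncountable and in which every subset definable with parameters is countable or co-countable. Let \(p(x)\in S_1(M)\) be its generic type, consisting of all formulas with parameters from \(M\) that define an uncountable (equivalently, co-countable) set. For \(X\subseteq M\) let \(\mathrm{cl}_p(X)=\{a\in M: a\not\models p|X\}\), and let \(\mathrm{ccl}(X)=\bigcup_{n\ge 1}\mathrm{cl}_p^{\,n}(X)\) be the union of the iterates of \(\mathrm{cl}_p\). Say that \(p\) is based on \(A\subseteq M\) if \(p\) does not split over \(A\) and \(\mathrm{ccl}(A\cup C)\ne M\) for every finite \(C\subseteq M\), and that \(p\) is countably based if it is based on some countable \(A\). A sequence \((a_i)_{i<\omega}\) is \(\mathrm{ccl}\)-free if \(a_i\notin\mathrm{ccl}(\{a_j:j<i\})\) for all \(i\). Suppose that \((M,\mathrm{ccl})\) is a pregeometry. Then: 1. \(p\) is definable (with parameters from \(M\)) and countably based. 2. \(p\) is symmetric, in the following sense. Let \(\bar M\) be any elementary extension of \(M\) that is \(\kappa\)-saturated for some \(\kappa>|M|\). Then \(p\) has a unique heir \(\bar p\in S_1(\bar M)\), this \(\bar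 p\) does not split over some set of size less than \(\kappa\), and for every \(n\), every formula \(\phi(x_1,\dots,x_n)\) over \(\bar M\) and every permutation \(\pi\) of \(\{1,\dots,n\}\), \[\phi(x_1,\dots,x_n)\in\bar p^{(n)}\iff\phi(x_{\pi(1)},\dots,x_{\pi(n)})\in\bar p^{(n)}.\] Here, if \(\bar p\) does not split over \(B\) with \(|B|<\kappa\), then \(\bar p^{(1)}=\bar p\), and \(\phi(x_1,\dots,x_{n+1},\bar c)\in\bar p^{(n+1)}\) if and only if \(\phi(a_1,\dots,a_n,x,\bar c)\in\bar p\) for some (equivalently, any) realization \((a_1,\dots,a_n)\) in \(\bar M\) of \(\bar p^{(n)}|(B\cup\bar c)\); this does not depend on \(B\). 3. There is an infinite countable \(\mathrm{ccl}\)-free sequence \((a_i)_{i<\omega}\) in \(M\) such that, with \(A=\{a_i:i<\omega\}\), the type \(p\) is based on \(A\), and such that, after adding constants for the elements of \(A\), \(M\) with the operator \(X\mapsto\mathrm{ccl}(A\cup X)\) is a homogeneous pregeometry: it is an infinite-dimensional pregeometry, and for every finite \(B\subseteq M\) the set \(M\setminus\mathrm{ccl}(A\cup B)\) is the set of realizations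 in \(M\) of a complete type over \(A\cup B\). -/

import Mathlib

open FirstOrder FirstOrder.Language Cardinal

universe u v w

namespace Quasimin

section Types

variable {L : FirstOrder.Language.{u, v}} {N : Type w} [L.Structure N]

/-- `S₁(N)`: the complete 1-types over (all of) the structure `N`, that is the complete types in one
variable over the theory of `N` in the language with a constant for every element of `N`. -/
abbrev OneType (L : FirstOrder.Language.{u, v}) (N : Type w) [L.Structure N] :=
  ((L[[N]]).completeTheory N).CompleteType (Fin 1)

/-- For an `L`-formula `φ(x̄, ȳ)` and a tuple `b` from `N`, the formula `φ(x̄, b)` with parameters. -/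
noncomputable def inst {α β : Type} (φ : L.Formula (α ⊕ β)) (b : β → N) : (L[[N]]).Formula α :=
  ((L.lhomWithConstants N).onFormula φ).subst
    (Sum.elim FirstOrder.Language.Term.var (fun i => FirstOrder.Language.Constants.term (L.con (b i))))

theorem realize_inst {α β : Type} (φ : L.Formula (α ⊕ β)) (b : β → N) (a : α → N) :
    (inst φ b).Realize a ↔ φ.Realize (Sum.elim a b) := by
  unfold inst FirstOrder.Language.Formula.Realize
  rw [FirstOrder.Language.BoundedFormula.realize_subst]
  have h : (fun i : α ⊕ β => FirstOrder.Language.Term.realize a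
      (Sum.elim FirstOrder.Language.Term.var
        (fun i => FirstOrder.Language.Constants.term (L.con (b i))) i :
          (L[[N]]).Term α)) = Sum.elim a b := by
    funext i
    cases i with
    | inl i => simp
    | inr i =>
      simp only [Sum.elim_inr, FirstOrder.Language.Term.realize_constants]
      rfl
  rw [h]
  exact FirstOrder.Language.LHom.realize_onFormula (L.lhomWithConstants N) φ

/-- The formula `φ(x)` with parameters from `N` belongs to the type `p(x)`. -/
def Mem (φ : (L[[N]]).Formula (Fin 1)) (p : OneType L N) : Prop :=
  FirstOrder.Language.Formula.equivSentence φ ∈ p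

/-- `φ(x, b) ∈ p(x)`, for an `L`-formula `φ(x, ȳ)` and a tuple `b` from `N`. -/
def Holds {β : Type} (p : OneType L N) (φ : L.Formula (Fin 1 ⊕ β)) (b : β → N) : Prop :=
  Mem (inst φ b) p

/-- `tp(b/A) = tp(b'/A)`. -/
def SameType (L : FirstOrder.Language.{u, v}) {N : Type w} [L.Structure N] (A : Set N) {k : ℕ}
    (b b' : Fin k → N) : Prop :=
  ∀ (m : ℕ) (ψ : L.Formula (Fin k ⊕ Fin m)) (c : Fin m → N), (∀ i, c i ∈ A) →
    (ψ.Realize (Sum.elim b c) ↔ ψ.Realize (Sum.elim b' c))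

/-- `a` realizes the restriction `p|X`. -/
def RealizesRestr (p : OneType L N) (X : Set N) (a : N) : Prop :=
  ∀ (m : ℕ) (φ : L.Formula (Fin 1 ⊕ Fin m)) (c : Fin m → N), (∀ i, c i ∈ X) →
    Holds p φ c → φ.Realize (Sum.elim (fun _ => a) c)

/-- `cl_p(X)`: the elements that do not realize `p|X`. -/
def clp (p : OneType L N) (X : Set N) : Set N :=
  {a | ¬ RealizesRestr p X a}

/-- `ccl(X)`: the union of the iterates `cl_p(X)`, `cl_p(cl_p(X))`, ... . -/
def ccl (p : OneType L N) (X : Set N) : Set N :=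
  ⋃ n : ℕ, (clp p)^[n + 1] X

/-- `p` is a definable type: for every `L`-formula `φ(x, ȳ)` the set of all `b` in `N` with
`φ(x, b) ∈ p` is definable in `N` with parameters. -/
def IsDefinableType (p : OneType L N) : Prop :=
  ∀ (k : ℕ) (φ : L.Formula (Fin 1 ⊕ Fin k)),
    (Set.univ : Set N).Definable L {b : Fin k → N | Holds p φ b}

/-- `p` does not split over `A`: for every formula `φ(x, ȳ, c)` with parameters `c` from `A`, and all
`b`, `b'` with the same type over `A`, the formula `φ(x, b, c) ↔ φ(x, b', c)` is in `p`. -/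
def DoesNotSplitOver (p : OneType L N) (A : Set N) : Prop :=
  ∀ (k m : ℕ) (φ : L.Formula (Fin 1 ⊕ (Fin k ⊕ Fin m))) (c : Fin m → N) (b b' : Fin k → N),
    (∀ i, c i ∈ A) → SameType L A b b' →
      Mem ((inst φ (Sum.elim b c)).iff (inst φ (Sum.elim b' c))) p

/-- `p` is based on `A`: it does not split over `A`, and `ccl(A ∪ C)` is a proper subset of the
structure for every finite set `C`. -/
def IsBasedOn (p : OneType L N) (A : Set N) : Prop :=
  DoesNotSplitOver p A ∧ ∀ C : Set N, C.Finite → ccl p (A ∪ C) ≠ Set.univ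

/-- `p` is countably based. -/
def IsCountablyBased (p : OneType L N) : Prop :=
  ∃ A : Set N, A.Countable ∧ IsBasedOn p A

end Types

section Pregeometries

variable {P : Type w}

/-- `(P, cl)` is a pregeometry. -/
structure IsPregeometry (cl : Set P → Set P) : Prop where
  subset_cl : ∀ A, A ⊆ cl A
  mono : ∀ A B, A ⊆ B → cl A ⊆ cl B
  finite_character : ∀ A, cl A = ⋃ A₀ ∈ {A₀ : Set P | A₀ ⊆ A ∧ A₀.Finite}, cl A₀
  transitive : ∀ A, cl (cl A) = cl A
  exchange : ∀ (A : Set P) (a b : P), a ∈ cl (A ∪ {b}) \ cl A → b ∈ cl (A ∪ {a})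

/-- `(a₀, a₁, ...)` is a `cl`-free sequence. -/
def IsFreeSeq (cl : Set P → Set P) (a : ℕ → P) : Prop :=
  ∀ i, a i ∉ cl (a '' Set.Iio i)

/-- There is an infinite `cl`-independent set. -/
def IsInfiniteDimensional (cl : Set P → Set P) : Prop :=
  ∃ I : Set P, I.Infinite ∧ ∀ a ∈ I, a ∉ cl (I \ {a})

/-- `(M, cl)` is a homogeneous pregeometry with respect to the language `L` expanded by constants
for the elements of `A`: it is an infinite-dimensional pregeometry and, for every finite `B`, the
complement of `cl B` is the set of realizations in `M` of a complete type over `A ∪ B`.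
(In infinite dimension `cl B` is a proper subset, so this type is `tp(a₀/A ∪ B)` for some `a₀`.) -/
def IsHomogeneousPregeometryOver (L : FirstOrder.Language.{u, v}) {M : Type w} [L.Structure M]
    (A : Set M) (cl : Set M → Set M) : Prop :=
  IsPregeometry cl ∧ IsInfiniteDimensional cl ∧
    ∀ B : Set M, B.Finite → ∃ a₀ : M, ∀ a : M, a ∉ cl B ↔ SameType L (A ∪ B) ![a] ![a₀]

end Pregeometries

section Global

variable {L : FirstOrder.Language.{u, v}} {M N : Type w} [L.Structure M] [L.Structure N]

/-- `N` is `κ`-saturated: every finitely satisfiable set of formulas in one variable over a set of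
fewer than `κ` parameters is realized in `N`. -/
def IsSaturated (L : FirstOrder.Language.{u, v}) (κ : Cardinal.{w}) (N : Type w)
    [L.Structure N] : Prop :=
  ∀ A : Set N, #A < κ → ∀ Γ : Set ((L[[A]]).Formula (Fin 1)),
    (∀ Γ₀ : Set ((L[[A]]).Formula (Fin 1)), Γ₀ ⊆ Γ → Γ₀.Finite →
      ∃ a : N, ∀ φ ∈ Γ₀, φ.Realize (fun _ => a)) →
    ∃ a : N, ∀ φ ∈ Γ, φ.Realize (fun _ => a)

/-- `q ∈ S₁(N)` is an heir of `p ∈ S₁(M)`, where `f` embeds `M` elementarily into `N`: it extends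
`p`, and whenever `φ(x, c, f d) ∈ q` with `c` from `N` and `d` from `M`, there is a tuple `b` from
`M` with `φ(x, b, d) ∈ p`. -/
def IsHeir (f : M ↪ₑ[L] N) (p : OneType L M) (q : OneType L N) : Prop :=
  (∀ (k : ℕ) (φ : L.Formula (Fin 1 ⊕ Fin k)) (b : Fin k → M), Holds p φ b → Holds q φ (f ∘ b)) ∧
  ∀ (k m : ℕ) (φ : L.Formula (Fin 1 ⊕ (Fin k ⊕ Fin m))) (c : Fin k → N) (d : Fin m → M),
    Holds q φ (Sum.elim c (f ∘ d)) → ∃ b : Fin k → M, Holds p φ (Sum.elim b d)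

/-- Regroup the variables of `φ(x₁, …, xₙ, xₙ₊₁, z̄)`, singling out `xₙ₊₁`. -/
def lastVar {n k : ℕ} (φ : L.Formula (Fin (n + 1) ⊕ Fin k)) :
    L.Formula (Fin 1 ⊕ (Fin n ⊕ Fin k)) :=
  φ.relabel (Sum.elim
    (Fin.lastCases (motive := fun _ => Fin 1 ⊕ (Fin n ⊕ Fin k)) (Sum.inl 0)
      (fun i => Sum.inr (Sum.inl i)))
    (fun j => Sum.inr (Sum.inr j)))

/-- The iterates `q⁽ⁿ⁾(x₁, …, xₙ)` of a global type `q` that is invariant over `A`: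
`Iter q A n φ c` says `φ(x₁, …, xₙ, c) ∈ q⁽ⁿ⁾`. The formula `φ(x₁, …, xₙ₊₁, c)` is in `q⁽ⁿ⁺¹⁾` when
for some realization `a` of the restriction of `q⁽ⁿ⁾` to `A` and `c`, the formula `φ(a, x, c)` is in
`q(x)`. (`q⁽⁰⁾` consists of the true sentences.) -/
def Iter (q : OneType L N) (A : Set N) :
    (n : ℕ) → {k : ℕ} → L.Formula (Fin n ⊕ Fin k) → (Fin k → N) → Prop
  | 0, _, φ, c => φ.Realize (Sum.elim (fun i : Fin 0 => i.elim0) c)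
  | n + 1, _, φ, c => ∃ a : Fin n → N,
      (∀ (m : ℕ) (ψ : L.Formula (Fin n ⊕ Fin m)) (d : Fin m → N),
        (∀ i, d i ∈ A ∪ Set.range c) → Iter q A n ψ d → ψ.Realize (Sum.elim a d)) ∧
      Holds q (lastVar φ) (Sum.elim a c)

/-- The global type `q` (over a `κ`-saturated structure, "small" meaning of size less than `κ`) is
invariant and symmetric: it does not split over some small set `A`, and each iterate `q⁽ⁿ⁾`, formed
by means of `A`, is preserved by all permutations of its `n` variables. (The iterates do not depend
on the choice of the small set `A`.) -/
def IsSymmetric (κ : Cardinal.{w}) (q : OneType L N) : Prop :=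
  ∃ A : Set N, #A < κ ∧ DoesNotSplitOver q A ∧
    ∀ (n k : ℕ) (φ : L.Formula (Fin n ⊕ Fin k)) (c : Fin k → N) (π : Equiv.Perm (Fin n)),
      Iter q A n φ c ↔ Iter q A n (φ.relabel (Sum.map π id)) c

end Global

section Quasiminimal

/-- `M` is a quasiminimal structure: the language is countable, `M` is uncountable, and every
subset of `M` definable with parameters is countable or co-countable. -/
structure IsQuasiminimal (L : FirstOrder.Language.{u, v}) (M : Type w) [L.Structure M] : Prop where
  countable_language : Countable L.Symbols
  uncountable : Uncountable M
  countable_or_cocountable : ∀ S : Set M, (Set.univ : Set M).Definable₁ L S →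
    S.Countable ∨ Sᶜ.Countable

variable {L : FirstOrder.Language.{u, v}} {M : Type w} [L.Structure M]

theorem IsQuasiminimal.formula_cases (h : IsQuasiminimal L M) (φ : (L[[M]]).Formula (Fin 1)) :
    {a : M | φ.Realize (fun _ => a)}.Countable ∨ {a : M | ¬ φ.Realize (fun _ => a)}.Countable := by
  refine h.countable_or_cocountable {a : M | φ.Realize (fun _ => a)} ?_
  unfold Set.Definable₁
  rw [Set.definable_iff_exists_formula_sum]
  refine ⟨FirstOrder.Language.Formula.relabel
    (Sum.map (fun m => (⟨m, trivial⟩ : (Set.univ : Set M))) id)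
    (FirstOrder.Language.BoundedFormula.constantsVarsEquiv φ : L.Formula (M ⊕ Fin 1)), ?_⟩
  ext x
  have hx : (fun _ : Fin 1 => x 0) = x := by
    funext i
    rw [Subsingleton.elim i 0]
  have key := FirstOrder.Language.BoundedFormula.realize_constantsVarsEquiv
    (φ := φ) (v := x) (xs := (default : Fin 0 → M))
  change φ.Realize (fun _ => x 0) ↔ FirstOrder.Language.Formula.Realize _ _
  rw [FirstOrder.Language.Formula.realize_relabel, hx]
  refine key.symm.trans (iff_of_eq ?_)
  unfold FirstOrder.Language.Formula.Realize
  congr 1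
  funext i
  cases i <;> rfl

/-- The generic type of a quasiminimal structure: it consists of the formulas that define a
co-countable (equivalently, an uncountable) subset of `M`. -/
def genericType (h : IsQuasiminimal L M) : OneType L M where
  toTheory := {σ | {a : M | ¬ (FirstOrder.Language.Formula.equivSentence.symm σ).Realize
    (fun _ : Fin 1 => a)}.Countable}
  subset' := by
    have := h.uncountable
    intro σ hσ
    have e : {a : M | ¬ (FirstOrder.Language.Formula.equivSentence.symm σ).Realize
        (fun _ : Fin 1 => a)} = ∅ := by
      rw [Set.eq_empty_iff_forall_notMem]
      intro a ha
      exact ha (FirstOrder.Language.Theory.CompleteType.mem_typeOf.1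
        ((((L[[M]]).completeTheory M).typeOf (fun _ : Fin 1 => a)).subset hσ))
    change Set.Countable _
    rw [e]
    exact Set.countable_empty
  isMaximal' := by
    have := h.uncountable
    refine ⟨?_, fun σ => ?_⟩
    · rw [FirstOrder.Language.Theory.isSatisfiable_iff_isFinitelySatisfiable]
      intro T₀ hT₀
      have hc : (⋃ σ ∈ T₀, {a : M | ¬ (FirstOrder.Language.Formula.equivSentence.symm σ).Realize
          (fun _ : Fin 1 => a)}).Countable :=
        T₀.countable_toSet.biUnion (fun σ hσ => hT₀ hσ)
      obtain ⟨a, ha⟩ : ∃ a, a ∉ (⋃ σ ∈ T₀,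
          {a : M | ¬ (FirstOrder.Language.Formula.equivSentence.symm σ).Realize
            (fun _ : Fin 1 => a)}) := by
        by_contra hcon
        push Not at hcon
        exact Set.not_countable_univ (hc.mono (fun a _ => hcon a))
      refine (((L[[M]]).completeTheory M).typeOf (fun _ : Fin 1 => a)).isMaximal.1.mono ?_
      intro σ hσ
      refine FirstOrder.Language.Theory.CompleteType.mem_typeOf.2 ?_
      by_contra hn
      exact ha (Set.mem_biUnion hσ hn)
    · rcases h.formula_cases (FirstOrder.Language.Formula.equivSentence.symm σ) with h1 | h1
      · right
        refine h1.mono (fun a ha => ?_)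
        by_contra hn
        refine ha ?_
        rw [FirstOrder.Language.Formula.realize_equivSentence_symm]
        intro hr
        exact hn ((FirstOrder.Language.Formula.realize_equivSentence_symm M σ _).2 hr)
      · exact Or.inl h1

theorem mem_genericType (h : IsQuasiminimal L M) (φ : (L[[M]]).Formula (Fin 1)) :
    Mem φ (genericType h) ↔ {a : M | ¬ φ.Realize (fun _ => a)}.Countable := by
  have e : Mem φ (genericType h) ↔ {a : M | ¬ (FirstOrder.Language.Formula.equivSentence.symm
      (FirstOrder.Language.Formula.equivSentence φ)).Realize (fun _ : Fin 1 => a)}.Countable :=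
    Iff.rfl
  rw [e, Equiv.symm_apply_apply]

theorem mem_genericType_iff_uncountable (h : IsQuasiminimal L M) (φ : (L[[M]]).Formula (Fin 1)) :
    Mem φ (genericType h) ↔ ¬ {a : M | φ.Realize (fun _ => a)}.Countable := by
  have := h.uncountable
  rw [mem_genericType]
  constructor
  · intro h1 h2
    refine Set.not_countable_univ ((h1.union h2).mono (fun a _ => ?_))
    by_cases ha : φ.Realize (fun _ => a)
    · exact Or.inr ha
    · exact Or.inl ha
  · intro h1
    exact (h.formula_cases φ).resolve_left h1

end Quasiminimal

end Quasimin

namespace Quasimin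

/-! ### Complete types over a structure, and limit types of sequences. -/

section TypeLemmas

variable {L : FirstOrder.Language.{u, v}} {N : Type w} [L.Structure N]

/-! Since `ccl` of a countable set is countable, no finite set spans and there is a free sequence
`a`. If `φ(x, b)` lies in the generic type `p` and `b` has length `k`, each `a i` failing `φ(x, b)`
lies in `cl_p(b)`; by Steinitz exchange, at most `k` terms do (`encard_setOf_mem_cl_le`). So along
`a` every instance of a formula with `k` parameters fails at most `k` times or holds at most `k`
times (`IsAlternationBounded`), and `p` is the limit type of `a`. Everything else follows from this
bound.

Majority vote among the first `2k + 1` terms decides `φ(x, b) ∈ p`, so `p` is definable over `a`. A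
limit type does not split over the sequence, so `p` is based on `a`. Definability over `a` also
makes `cl_p` idempotent on sets containing `a`; there the complement of `ccl` is the set of
realizations of a restriction of `p`, which gives homogeneity.

The bound passes to elementary extensions, and the unique heir is the limit type of the image of
`a`. Its iterates are iterated limits along `a`. A formula true in the `n`-fold limit fails on only
`O(|J|^(n-1))` of the tuples from a finite index set `J`. For large `J` such failures cannot cover
`J^n`, so permuting the variables cannot change membership: this is symmetry. -/

theorem exists_finite_params {γ α : Type*} (φ : L.Formula (γ ⊕ α)) :
    ∃ (m : ℕ) (ψ : L.Formula (α ⊕ Fin m)) (c : Fin m → γ), ∀ (u : γ → N) (v : α → N),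
      φ.Realize (Sum.elim u v) ↔ ψ.Realize (Sum.elim v (u ∘ c)) := by
  classical
  let s : Finset γ := φ.freeVarFinset.toLeft
  let e := s.equivFin
  let g : φ.freeVarFinset → α ⊕ Fin s.card := fun x =>
    match x with
    | ⟨Sum.inl y, h⟩ => Sum.inr (e ⟨y, Finset.mem_toLeft.2 h⟩)
    | ⟨Sum.inr y, _⟩ => Sum.inl y
  refine ⟨s.card, φ.restrictFreeVar g, fun i => (e.symm i : γ), fun u v => ?_⟩
  refine (BoundedFormula.realize_restrictFreeVar _ ?_).symm
  rintro ⟨y | y, h⟩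
  · simp [g]
  · simp [g]

theorem exists_inst (φ : (L[[N]]).Formula (Fin 1)) :
    ∃ (m : ℕ) (ψ : L.Formula (Fin 1 ⊕ Fin m)) (c : Fin m → N), ∀ a : Fin 1 → N,
      φ.Realize a ↔ (inst ψ c).Realize a := by
  obtain ⟨m, ψ, c, h⟩ := exists_finite_params (N := N)
    (BoundedFormula.constantsVarsEquiv φ : L.Formula (N ⊕ Fin 1))
  refine ⟨m, ψ, c, fun a => ?_⟩
  rw [realize_inst]
  refine Iff.trans ?_ (h id a)
  exact (BoundedFormula.realize_constantsVarsEquiv (φ := φ) (v := a)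
    (xs := (default : Fin 0 → N))).symm

theorem mem_not (φ : (L[[N]]).Formula (Fin 1)) (q : OneType L N) : Mem φ.not q ↔ ¬ Mem φ q := by
  unfold Mem
  rw [Formula.equivSentence_not]
  exact q.not_mem_iff _

theorem mem_of_realize [Nonempty N] (q : OneType L N) {φ : (L[[N]]).Formula (Fin 1)}
    (h : ∀ a : Fin 1 → N, φ.Realize a) : Mem φ q := by
  refine q.mem_of_models ?_
  rw [← Theory.models_formula_iff_onTheory_models_equivSentence, Theory.models_formula_iff]
  intro K v
  have hσ : (Formula.iAlls (Fin 1) (φ.relabel (Sum.inr : Fin 1 → Empty ⊕ Fin 1))) ∈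
      (L[[N]]).completeTheory N := by
    rw [mem_completeTheory]
    refine Formula.realize_iAlls.2 fun i => ?_
    rw [Formula.realize_relabel]
    exact h _
  have := Formula.realize_iAlls.1 (K.is_model.realize_of_mem _ hσ) v
  rwa [Formula.realize_relabel] at this

theorem mem_imp {q : OneType L N} {φ ψ : (L[[N]]).Formula (Fin 1)} (h : Mem (φ.imp ψ) q)
    (hφ : Mem φ q) : Mem ψ q := by
  by_contra hn
  obtain ⟨K⟩ := q.isMaximal.1
  have h1 := K.is_model.realize_of_mem _ h
  have h2 := K.is_model.realize_of_mem _ hφ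
  have h3 := K.is_model.realize_of_mem _ ((mem_not ψ q).2 hn)
  rw [Formula.equivSentence_not] at h3
  exact h3 (h1 h2)

theorem mem_of_realize_imp [Nonempty N] {q : OneType L N} {φ ψ : (L[[N]]).Formula (Fin 1)}
    (h : ∀ a : Fin 1 → N, φ.Realize a → ψ.Realize a) (hφ : Mem φ q) : Mem ψ q :=
  mem_imp (mem_of_realize q (φ := φ.imp ψ) h) hφ

theorem oneType_eq_of_holds [Nonempty N] {q r : OneType L N}
    (h : ∀ (m : ℕ) (φ : L.Formula (Fin 1 ⊕ Fin m)) (c : Fin m → N), Holds q φ c → Holds r φ c) :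
    q = r := by
  have key : ∀ φ : (L[[N]]).Formula (Fin 1), Mem φ q → Mem φ r := by
    intro φ hφ
    obtain ⟨m, ψ, c, hψ⟩ := exists_inst φ
    exact mem_of_realize_imp (fun a => (hψ a).2)
      (h m ψ c (mem_of_realize_imp (fun a => (hψ a).1) hφ))
  have key' : ∀ φ : (L[[N]]).Formula (Fin 1), Mem φ q ↔ Mem φ r := fun φ =>
    ⟨key φ, fun hr => by
      by_contra hq
      exact (mem_not φ r).1 (key _ ((mem_not φ q).2 hq)) hr⟩
  refine SetLike.ext fun σ => ?_
  have := key' (Formula.equivSentence.symm σ)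
  unfold Mem at this
  rwa [Equiv.apply_symm_apply] at this

/-- The limit of the types of the terms of a sequence, along a fixed nonprincipal ultrafilter. -/
noncomputable def limitType (L : FirstOrder.Language.{u, v}) {N : Type w} [L.Structure N]
    (a : ℕ → N) : OneType L N :=
  haveI : Nonempty N := ⟨a 0⟩
  { toTheory := {σ | ∀ᶠ i in Filter.hyperfilter ℕ,
      σ ∈ ((L[[N]]).completeTheory N).typeOf (fun _ : Fin 1 => a i)}
    subset' := fun _ hσ => Filter.Eventually.of_forall fun i =>
      (((L[[N]]).completeTheory N).typeOf (fun _ : Fin 1 => a i)).subset hσ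
    isMaximal' := by
      refine ⟨?_, fun σ => ?_⟩
      · rw [Theory.isSatisfiable_iff_isFinitelySatisfiable]
        intro T₀ hT₀
        obtain ⟨i, hi⟩ := ((Filter.eventually_all_finset T₀).2 fun σ hσ => hT₀ hσ).exists
        exact (((L[[N]]).completeTheory N).typeOf (fun _ : Fin 1 => a i)).isMaximal.1.mono hi
      · change (∀ᶠ i in (Filter.hyperfilter ℕ : Filter ℕ), _) ∨
          (∀ᶠ i in (Filter.hyperfilter ℕ : Filter ℕ), _)
        rw [← Ultrafilter.eventually_or]
        exact Filter.Eventually.of_forall fun i =>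
          (((L[[N]]).completeTheory N).typeOf (fun _ : Fin 1 => a i)).mem_or_not_mem σ }

theorem mem_limitType (a : ℕ → N) (φ : (L[[N]]).Formula (Fin 1)) :
    Mem φ (limitType L a) ↔ ∀ᶠ i in Filter.hyperfilter ℕ, φ.Realize (fun _ => a i) := by
  have : Nonempty N := ⟨a 0⟩
  change (∀ᶠ i in Filter.hyperfilter ℕ, Formula.equivSentence φ ∈
    ((L[[N]]).completeTheory N).typeOf (fun _ : Fin 1 => a i)) ↔ _
  simp only [Theory.CompleteType.mem_typeOf, Equiv.symm_apply_apply]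

theorem holds_limitType (a : ℕ → N) {β : Type} (φ : L.Formula (Fin 1 ⊕ β)) (c : β → N) :
    Holds (limitType L a) φ c ↔
      ∀ᶠ i in Filter.hyperfilter ℕ, φ.Realize (Sum.elim (fun _ => a i) c) := by
  simp only [Holds, mem_limitType, realize_inst]

/-- An element of `A` in place of `x` is just one more parameter from `A`. -/
theorem sameType_iff_of_mem {A : Set N} {k : ℕ} {b b' : Fin k → N} (h : SameType L A b b')
    {m : ℕ} {c : Fin m → N} (hc : ∀ i, c i ∈ A) {a : N} (ha : a ∈ A)
    (φ : L.Formula (Fin 1 ⊕ (Fin k ⊕ Fin m))) :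
    φ.Realize (Sum.elim (fun _ => a) (Sum.elim b c)) ↔
      φ.Realize (Sum.elim (fun _ => a) (Sum.elim b' c)) := by
  let g : Fin 1 ⊕ (Fin k ⊕ Fin m) → Fin k ⊕ Fin (m + 1) :=
    Sum.elim (fun _ => Sum.inr (Fin.last m)) (Sum.elim Sum.inl (fun i => Sum.inr i.castSucc))
  have hg : ∀ b : Fin k → N, Sum.elim b (Fin.snoc c a : Fin (m + 1) → N) ∘ g =
      Sum.elim (fun _ => a) (Sum.elim b c) := by
    intro b
    funext x
    rcases x with x | x | x <;> simp [g]
  have := h (m + 1) (φ.relabel g) (Fin.snoc c a) (fun i => by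
    refine Fin.lastCases ?_ (fun j => ?_) i
    · simpa using ha
    · simpa using hc j)
  rwa [Formula.realize_relabel, Formula.realize_relabel, hg, hg] at this

theorem limitType_doesNotSplitOver (a : ℕ → N) {A : Set N} (hA : Set.range a ⊆ A) :
    DoesNotSplitOver (limitType L a) A := by
  intro k m φ c b b' hc hb
  rw [mem_limitType]
  refine Filter.Eventually.of_forall fun i => ?_
  rw [Formula.realize_iff, realize_inst, realize_inst]
  exact sameType_iff_of_mem hb hc (hA ⟨i, rfl⟩) φ

end TypeLemmas

end Quasimin

namespace Quasimin

/-! ### Pregeometries: exchange, free sequences, localization. -/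

namespace IsPregeometry

variable {P : Type w} {cl : Set P → Set P}

theorem exists_finite (h : IsPregeometry cl) {X : Set P} {a : P} (ha : a ∈ cl X) :
    ∃ X₀ ⊆ X, X₀.Finite ∧ a ∈ cl X₀ := by
  rw [h.finite_character X] at ha
  simp only [Set.mem_iUnion, Set.mem_ofPred_eq] at ha
  obtain ⟨X₀, ⟨h1, h2⟩, h3⟩ := ha
  exact ⟨X₀, h1, h2, h3⟩

theorem cl_subset (h : IsPregeometry cl) {X Y : Set P} (hXY : X ⊆ cl Y) : cl X ⊆ cl Y := by
  rw [← h.transitive Y]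
  exact h.mono _ _ hXY

/-- Steinitz exchange: an independent set is at most as large as a spanning one. -/
theorem card_le_of_subset_cl [DecidableEq P] (h : IsPregeometry cl) {n : ℕ} (b : Fin n → P) :
    ∀ (X : Set P) (I : Finset P), (∀ a ∈ I, a ∉ cl (X ∪ (I.erase a : Finset P))) →
      (I : Set P) ⊆ cl (X ∪ Set.range b) → I.card ≤ n := by
  induction n with
  | zero =>
    intro X I hI hb
    rw [Nat.le_zero, Finset.card_eq_zero, Finset.eq_empty_iff_forall_notMem]
    intro a ha
    refine hI a ha (h.mono _ _ ?_ (hb ha))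
    simp
  | succ n ih =>
    intro X I hI hb
    have hr : Set.range b = Set.range (Fin.init b) ∪ {b (Fin.last n)} := by
      ext y
      simp [Fin.exists_fin_succ', Fin.init, eq_comm, or_comm]
    by_cases hcase : (I : Set P) ⊆ cl (X ∪ Set.range (Fin.init b))
    · exact (ih (Fin.init b) X I hI hcase).trans n.le_succ
    · obtain ⟨e, heI, he⟩ := Set.not_subset.1 hcase
      have heI : e ∈ I := heI
      -- Exchange trades the last spanning element for `e`, which then moves into the base `X`. This
      -- is why the induction is stated for all `X`.
      have hexch : b (Fin.last n) ∈ cl ((X ∪ Set.range (Fin.init b)) ∪ {e}) := by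
        refine h.exchange _ _ _ ⟨?_, he⟩
        rw [Set.union_assoc, ← hr]
        exact hb heI
      have := ih (Fin.init b) (X ∪ {e}) (I.erase e) ?_ ?_
      · rw [Finset.card_erase_of_mem heI] at this
        omega
      · intro a ha hcl
        refine hI a (Finset.mem_of_mem_erase ha) (h.mono _ _ ?_ hcl)
        rintro y ((hy | hy) | hy)
        · exact Or.inl hy
        · rw [Set.mem_singleton_iff] at hy
          subst hy
          exact Or.inr (Finset.mem_erase.2 ⟨(Finset.ne_of_mem_erase ha).symm, heI⟩)
        · simp only [Finset.coe_erase] at hy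
          right
          simp [hy.1.1, hy.2]
      · intro a ha
        refine h.cl_subset ?_ (hb (Finset.mem_of_mem_erase ha))
        rw [hr]
        rintro y (hy | hy | hy)
        · exact h.subset_cl _ (Or.inl (Or.inl hy))
        · exact h.subset_cl _ (Or.inr hy)
        · rw [Set.mem_singleton_iff] at hy
          subst hy
          refine h.mono _ _ ?_ hexch
          rintro z ((hz | hz) | hz)
          · exact Or.inl (Or.inl hz)
          · exact Or.inr hz
          · exact Or.inl (Or.inr hz)

theorem injective_of_isFreeSeq (h : IsPregeometry cl) {a : ℕ → P} (ha : IsFreeSeq cl a) :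
    Function.Injective a := by
  have key : ∀ i j, i < j → a i ≠ a j := fun i j hij he =>
    ha j (h.subset_cl _ ⟨i, hij, he⟩)
  intro i j hij
  by_contra hne
  rcases lt_or_gt_of_ne hne with hlt | hlt
  · exact key _ _ hlt hij
  · exact key _ _ hlt hij.symm

/-- The terms of a free sequence are independent. -/
theorem notMem_of_isFreeSeq (h : IsPregeometry cl) {a : ℕ → P} (ha : IsFreeSeq cl a) (i : ℕ) :
    a i ∉ cl (a '' {i}ᶜ) := by
  -- Freeness only controls earlier terms. Later ones are admitted one at a time: if adding `a n`
  -- captured `a i`, exchange would put `a n` in the closure of its predecessors.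
  have key : ∀ n, a i ∉ cl (a '' (Set.Iio n \ {i})) := by
    intro n
    induction n with
    | zero => exact fun hc => ha i (h.mono _ _ (by simp) hc)
    | succ n ih =>
      intro hc
      by_cases hn : n ≤ i
      · refine ha i (h.mono _ _ (Set.image_mono ?_) hc)
        rintro j ⟨hj, hji⟩
        simp only [Set.mem_Iio, Set.mem_singleton_iff] at hj hji ⊢
        omega
      · have hsplit : a '' (Set.Iio (n + 1) \ {i}) = a '' (Set.Iio n \ {i}) ∪ {a n} := by
          rw [← Set.image_singleton, ← Set.image_union]
          congr 1
          ext j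
          simp only [Set.mem_sdiff, Set.mem_Iio, Set.mem_singleton_iff, Set.mem_union]
          omega
        rw [hsplit] at hc
        refine ha n (h.mono _ _ ?_ (h.exchange _ _ _ ⟨hc, ih⟩))
        rw [← Set.image_singleton, ← Set.image_union]
        refine Set.image_mono ?_
        intro j
        simp only [Set.mem_sdiff, Set.mem_Iio, Set.mem_singleton_iff, Set.mem_union]
        omega
  intro hc
  obtain ⟨X₀, hX₀, hfin, hmem⟩ := h.exists_finite hc
  obtain ⟨s, hs, hsX⟩ := (Set.subset_image_iff.1 hX₀)
  have hsfin : s.Finite := by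
    refine Set.Finite.of_finite_image (f := a) (hsX ▸ hfin)
      (h.injective_of_isFreeSeq ha).injOn
  obtain ⟨n, hn⟩ := hsfin.bddAbove
  refine key (n + 1) (h.mono _ _ ?_ hmem)
  rw [← hsX]
  refine Set.image_mono fun j hj => ⟨?_, hs hj⟩
  exact Nat.lt_succ_of_le (hn hj)

/-- Steinitz exchange over the empty base, for the independent terms `a i`. This is the source of
every numerical bound below. -/
theorem encard_setOf_mem_cl_le (h : IsPregeometry cl) {a : ℕ → P} (ha : IsFreeSeq cl a) {n : ℕ}
    (b : Fin n → P) : {i | a i ∈ cl (Set.range b)}.encard ≤ n := by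
  classical
  by_contra hlt
  rw [not_le] at hlt
  obtain ⟨s, hs, hcard⟩ := Set.exists_subset_encard_eq (Order.add_one_le_of_lt hlt)
  have hsfin : s.Finite := Set.finite_of_encard_eq_coe (k := n + 1) (by rw [hcard]; norm_cast)
  lift s to Finset ℕ using hsfin
  have hinj := h.injective_of_isFreeSeq ha
  have := h.card_le_of_subset_cl b ∅ (s.image a) ?_ ?_
  · rw [Finset.card_image_of_injective _ hinj] at this
    rw [Set.encard_coe_eq_coe_finsetCard] at hcard
    have : s.card = n + 1 := by exact_mod_cast hcard
    omega
  · intro y hy hc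
    obtain ⟨i, -, rfl⟩ := Finset.mem_image.1 hy
    refine h.notMem_of_isFreeSeq ha i (h.mono _ _ ?_ hc)
    rintro z (hz | hz)
    · exact hz.elim
    · obtain ⟨hne, hz⟩ := Finset.mem_erase.1 hz
      obtain ⟨j, -, rfl⟩ := Finset.mem_image.1 hz
      exact ⟨j, fun hj => hne (congrArg a hj), rfl⟩
  · intro y hy
    obtain ⟨i, hi, rfl⟩ := Finset.mem_image.1 hy
    rw [Set.empty_union]
    exact hs hi

/-- The localization of a pregeometry at a set is a pregeometry. -/
theorem localize (h : IsPregeometry cl) (A : Set P) : IsPregeometry fun X => cl (A ∪ X) where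
  subset_cl X := Set.subset_union_right.trans (h.subset_cl _)
  mono X Y hXY := h.mono _ _ (Set.union_subset_union_right A hXY)
  finite_character X := by
    refine Set.Subset.antisymm ?_ ?_
    · intro a ha
      obtain ⟨X₀, hX₀, hfin, hmem⟩ := h.exists_finite ha
      refine Set.mem_biUnion (x := X₀ ∩ X) ⟨Set.inter_subset_right, hfin.inter_of_left X⟩ ?_
      refine h.mono _ _ ?_ hmem
      intro y hy
      exact (hX₀ hy).imp id fun hyX => ⟨hy, hyX⟩
    · exact Set.iUnion₂_subset fun X₀ hX₀ =>
        h.mono _ _ (Set.union_subset_union_right A hX₀.1)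
  transitive X := by
    refine Set.Subset.antisymm (h.cl_subset ?_)
      (h.mono _ _ (Set.union_subset_union_right A
        (Set.subset_union_right.trans (h.subset_cl _))))
    exact Set.union_subset (Set.subset_union_left.trans (h.subset_cl _)) subset_rfl
  exchange X a b hab := by
    rw [← Set.union_assoc] at hab ⊢
    exact h.exchange _ _ _ hab

theorem isInfiniteDimensional (h : IsPregeometry cl) {a : ℕ → P} (ha : IsFreeSeq cl a) :
    IsInfiniteDimensional cl := by
  refine ⟨Set.range a, Set.infinite_range_of_injective (h.injective_of_isFreeSeq ha), ?_⟩
  rintro _ ⟨i, rfl⟩ hc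
  refine h.notMem_of_isFreeSeq ha i (h.mono _ _ ?_ hc)
  rintro _ ⟨⟨j, rfl⟩, hj⟩
  exact ⟨j, fun hji => hj (congrArg a hji), rfl⟩

end IsPregeometry

/-- If no finite set spans, there is a free sequence. -/
theorem exists_isFreeSeq {P : Type w} {cl : Set P → Set P}
    (hcl : ∀ X : Set P, X.Finite → cl X ≠ Set.univ) : ∃ a : ℕ → P, IsFreeSeq cl a := by
  have h : ∀ X : Set P, X.Finite → ∃ y, y ∉ cl X := fun X hX => by
    simpa [Set.ne_univ_iff_exists_notMem] using hcl X hX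
  obtain ⟨y₀, -⟩ := h ∅ Set.finite_empty
  have : Nonempty P := ⟨y₀⟩
  choose! g hg using h
  let F : List P → P := fun l => g {y | y ∈ l}
  -- `l n` lists the first `n` terms, so that each new term can be chosen outside the closure of all
  -- earlier ones.
  let l : ℕ → List P := fun n => Nat.rec [] (fun _ l => F l :: l) n
  have hl : ∀ n, {y | y ∈ l n} = (fun i => F (l i)) '' Set.Iio n := by
    intro n
    induction n with
    | zero => simp [l]
    | succ n ih =>
      have : Set.Iio (n + 1) = insert n (Set.Iio n) := by
        ext j
        simp only [Set.mem_Iio, Set.mem_insert_iff]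
        omega
      rw [this, Set.image_insert_eq, ← ih]
      ext y
      change y ∈ F (l n) :: l n ↔ _
      simp
  refine ⟨fun i => F (l i), fun i => ?_⟩
  rw [← hl]
  exact hg _ (List.finite_toSet (l i))

end Quasimin

namespace Quasimin

/-! ### Sequences of bounded alternation and definability by majority vote. -/

section Closure

variable {L : FirstOrder.Language.{u, v}} {N : Type w} [L.Structure N]

theorem definable_realize {α β : Type*} {X : Set N} (φ : L.Formula β) (g : β → X ⊕ α) :
    X.Definable L {v : α → N | φ.Realize (fun b => Sum.elim (fun x : X => (x : N)) v (g b))} := by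
  refine Set.definable_iff_exists_formula_sum.2 ⟨φ.relabel g, ?_⟩
  ext v
  simp only [Set.mem_ofPred_eq, Formula.realize_relabel]
  rfl

/-- A sequence such that no formula with `k` parameters both holds and fails more than `k` times
along it. -/
def IsAlternationBounded (L : FirstOrder.Language.{u, v}) {N : Type w} [L.Structure N]
    (a : ℕ → N) : Prop :=
  ∀ (k : ℕ) (φ : L.Formula (Fin 1 ⊕ Fin k)) (c : Fin k → N),
    {i | φ.Realize (Sum.elim (fun _ => a i) c)}.encard ≤ k ∨
      {i | ¬ φ.Realize (Sum.elim (fun _ => a i) c)}.encard ≤ k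

theorem not_eventually_hyperfilter_of_encard_le {s : Set ℕ} {k : ℕ} (h : s.encard ≤ k) :
    ¬ ∀ᶠ i in Filter.hyperfilter ℕ, i ∈ s :=
  Filter.notMem_hyperfilter_of_finite (Set.finite_of_encard_le_coe h)

theorem IsAlternationBounded.encard_not_le {a : ℕ → N} (h : IsAlternationBounded L a) {k : ℕ}
    {φ : L.Formula (Fin 1 ⊕ Fin k)} {c : Fin k → N} (hφ : Holds (limitType L a) φ c) :
    {i | ¬ φ.Realize (Sum.elim (fun _ => a i) c)}.encard ≤ k := by
  rw [holds_limitType] at hφ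
  exact (h k φ c).resolve_left fun hk => not_eventually_hyperfilter_of_encard_le hk hφ

theorem IsAlternationBounded.encard_le {a : ℕ → N} (h : IsAlternationBounded L a) {k : ℕ}
    {φ : L.Formula (Fin 1 ⊕ Fin k)} {c : Fin k → N} (hφ : ¬ Holds (limitType L a) φ c) :
    {i | φ.Realize (Sum.elim (fun _ => a i) c)}.encard ≤ k := by
  rw [holds_limitType, ← Ultrafilter.eventually_not] at hφ
  exact (h k φ c).resolve_right fun hk => not_eventually_hyperfilter_of_encard_le hk hφ

theorem IsAlternationBounded.holds_of_card {a : ℕ → N} (h : IsAlternationBounded L a) {k : ℕ}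
    {φ : L.Formula (Fin 1 ⊕ Fin k)} {c : Fin k → N} {I : Finset ℕ} (hI : k < I.card)
    (hφ : ∀ i ∈ I, φ.Realize (Sum.elim (fun _ => a i) c)) : Holds (limitType L a) φ c := by
  by_contra hn
  have h1 : (I : Set ℕ).encard ≤ k :=
    (Set.encard_le_encard (fun i hi => hφ i hi)).trans (h.encard_le hn)
  rw [Set.encard_coe_eq_coe_finsetCard] at h1
  exact hI.not_ge (by exact_mod_cast h1)

/-- With at most `k` exceptions overall, `2k + 1` indices leave a majority of `k + 1`, which is just
enough for `holds_of_card`. -/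
theorem exists_subset_of_encard_le {P : ℕ → Prop} {k : ℕ}
    (h : {i | ¬ P i}.encard ≤ k) :
    ∃ I ∈ (Finset.range (2 * k + 1)).powersetCard (k + 1), ∀ i ∈ I, P i := by
  classical
  have h1 : ((Finset.range (2 * k + 1)).filter fun i => ¬ P i).card ≤ k := by
    have : (((Finset.range (2 * k + 1)).filter fun i => ¬ P i : Finset ℕ) : Set ℕ).encard ≤ k :=
      (Set.encard_le_encard (fun i hi => by simpa using (Finset.mem_filter.1 hi).2)).trans h
    rw [Set.encard_coe_eq_coe_finsetCard] at this
    exact_mod_cast this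
  have h2 := Finset.card_filter_add_card_filter_not (s := Finset.range (2 * k + 1)) P
  rw [Finset.card_range] at h2
  obtain ⟨I, hI, hc⟩ := Finset.exists_subset_card_eq
    (s := (Finset.range (2 * k + 1)).filter P) (n := k + 1) (by omega)
  exact ⟨I, Finset.mem_powersetCard.2 ⟨hI.trans (Finset.filter_subset _ _), hc⟩,
    fun i hi => (Finset.mem_filter.1 (hI hi)).2⟩

/-- `φ(x, b)` is in the limit type exactly when it holds at `k + 1` of the first `2k + 1` terms, a
first-order condition on `b`. -/
theorem IsAlternationBounded.isDefinableType {a : ℕ → N} (h : IsAlternationBounded L a) :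
    IsDefinableType (limitType L a) := by
  intro k φ
  have : {b : Fin k → N | Holds (limitType L a) φ b} =
      ⋃ I ∈ (Finset.range (2 * k + 1)).powersetCard (k + 1),
        ⋂ i ∈ I, {b : Fin k → N | φ.Realize (Sum.elim (fun _ => a i) b)} := by
    ext b
    simp only [Set.mem_ofPred_eq, Set.mem_iUnion, Set.mem_iInter, exists_prop]
    refine ⟨fun hb => exists_subset_of_encard_le (h.encard_not_le hb), ?_⟩
    rintro ⟨I, hI, hb⟩
    refine h.holds_of_card ?_ hb
    rw [(Finset.mem_powersetCard.1 hI).2]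
    exact k.lt_succ_self
  rw [this]
  refine Set.definable_biUnion_finset (fun I => Set.definable_biInter_finset (fun i => ?_) _) _
  convert definable_realize (X := Set.univ) φ
    (Sum.elim (fun _ => Sum.inl ⟨a i, trivial⟩) Sum.inr) using 4 with b
  funext x
  cases x <;> rfl

end Closure

/-! ### The generic type as a limit type, and its closure operators. -/

section Generic

variable {L : FirstOrder.Language.{u, v}} {M : Type w} [L.Structure M] (hM : IsQuasiminimal L M)

theorem holds_genericType_iff {β : Type} (φ : L.Formula (Fin 1 ⊕ β)) (b : β → M) :
    Holds (genericType hM) φ b ↔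
      {a : M | ¬ φ.Realize (Sum.elim (fun _ => a) b)}.Countable := by
  simp only [Holds, mem_genericType, realize_inst]

theorem not_holds_genericType_iff {β : Type} (φ : L.Formula (Fin 1 ⊕ β)) (b : β → M) :
    ¬ Holds (genericType hM) φ b ↔
      {a : M | φ.Realize (Sum.elim (fun _ => a) b)}.Countable := by
  simp only [Holds, mem_genericType_iff_uncountable, realize_inst, not_not]

theorem mem_clp_genericType {X : Set M} {a : M} :
    a ∈ clp (genericType hM) X ↔ ∃ S : Set M, S.Countable ∧ X.Definable₁ L S ∧ a ∈ S := by
  constructor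
  · intro ha
    have ha : ¬ RealizesRestr (genericType hM) X a := ha
    unfold RealizesRestr at ha
    push Not at ha
    obtain ⟨m, φ, c, hc, hφ, hn⟩ := ha
    refine ⟨_, (holds_genericType_iff hM φ c).1 hφ, ?_, hn⟩
    have := (definable_realize φ
      (Sum.elim Sum.inr (fun i => Sum.inl ⟨c i, hc i⟩) : Fin 1 ⊕ Fin m → X ⊕ Fin 1)).compl
    unfold Set.Definable₁
    convert this using 1
    ext v
    simp only [Set.mem_ofPred_eq, Set.mem_compl_iff]
    refine not_congr (iff_of_eq ?_)
    congr 1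
    funext x
    rcases x with x | x
    · exact congrArg v (Subsingleton.elim _ _)
    · rfl
  · rintro ⟨S, hS, hdef, haS⟩ ha
    obtain ⟨φ, hφ⟩ := Set.definable_iff_exists_formula_sum.1 hdef
    obtain ⟨m, ψ, c, hψ⟩ := exists_finite_params (N := M) φ
    have key : ∀ y : M, y ∈ S ↔ ψ.Realize (Sum.elim (fun _ => y) (fun i => (c i : M))) := by
      intro y
      refine Iff.trans ?_ (hψ (fun x => (x : M)) (fun _ => y))
      exact Set.ext_iff.1 hφ (fun _ => y)
    refine ha m ψ.not (fun i => c i) (fun i => (c i).2) ?_ ((key a).1 haS)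
    rw [holds_genericType_iff]
    refine hS.mono fun y hy => (key y).2 ?_
    exact not_not.1 hy

theorem subset_clp_genericType (X : Set M) : X ⊆ clp (genericType hM) X := by
  intro a ha
  refine (mem_clp_genericType hM).2 ⟨{a}, Set.countable_singleton a, ?_, rfl⟩
  exact Set.Definable.singleton_of_mem L ha

theorem clp_genericType_mono {X Y : Set M} (h : X ⊆ Y) :
    clp (genericType hM) X ⊆ clp (genericType hM) Y := by
  intro a ha
  obtain ⟨S, hS, hdef, haS⟩ := (mem_clp_genericType hM).1 ha
  exact (mem_clp_genericType hM).2 ⟨S, hS, hdef.mono h, haS⟩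

/-- A countable language and countable `X` give only countably many formulas over `X`, hence a
countable union of countable sets. -/
theorem countable_clp_genericType {X : Set M} (hX : X.Countable) :
    (clp (genericType hM) X).Countable := by
  have := hM.countable_language
  have := hX.to_subtype
  let T : L.Formula (X ⊕ Fin 1) → Set M := fun φ =>
    {y | φ.Realize (Sum.elim (fun x : X => (x : M)) (fun _ => y))}
  have : (⋃ φ ∈ {φ | (T φ).Countable}, T φ).Countable :=
    (Set.to_countable {φ | (T φ).Countable}).biUnion fun φ hφ => hφ
  refine this.mono fun a ha => ?_
  obtain ⟨S, hS, hdef, haS⟩ := (mem_clp_genericType hM).1 ha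
  obtain ⟨φ, hφ⟩ := Set.definable_iff_exists_formula_sum.1 hdef
  have key : S = T φ := by
    ext y
    exact Set.ext_iff.1 hφ (fun _ => y)
  subst key
  exact Set.mem_biUnion hS haS

theorem clp_subset_ccl {p : OneType L M} (X : Set M) : clp p X ⊆ ccl p X :=
  Set.subset_iUnion (fun n : ℕ => (clp p)^[n + 1] X) 0

theorem countable_ccl_genericType {X : Set M} (hX : X.Countable) :
    (ccl (genericType hM) X).Countable := by
  have key : ∀ n, ((clp (genericType hM))^[n] X).Countable := by
    intro n
    induction n with
    | zero => exact hX
    | succ n ih =>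
      rw [Function.iterate_succ_apply']
      exact countable_clp_genericType hM ih
  exact Set.countable_iUnion fun n => key (n + 1)

theorem ccl_genericType_ne_univ {X : Set M} (hX : X.Countable) :
    ccl (genericType hM) X ≠ Set.univ := by
  intro h
  have := hM.uncountable
  exact Set.not_countable_univ (h ▸ countable_ccl_genericType hM hX)

variable {hM}

/-- A term at which `φ(x, b)` fails does not realize `p` restricted to `b`, so it lies in the
closure of the `k` entries of `b`. -/
theorem encard_not_realize_le (hccl : IsPregeometry (ccl (genericType hM))) {a : ℕ → M}
    (ha : IsFreeSeq (ccl (genericType hM)) a) {k : ℕ} {φ : L.Formula (Fin 1 ⊕ Fin k)}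
    {b : Fin k → M} (h : Holds (genericType hM) φ b) :
    {i | ¬ φ.Realize (Sum.elim (fun _ => a i) b)}.encard ≤ k := by
  refine (Set.encard_le_encard fun i hi => ?_).trans (hccl.encard_setOf_mem_cl_le ha b)
  exact clp_subset_ccl _ fun hr => hi (hr k φ b (fun j => ⟨j, rfl⟩) h)

theorem isAlternationBounded_of_isFreeSeq (hccl : IsPregeometry (ccl (genericType hM)))
    {a : ℕ → M} (ha : IsFreeSeq (ccl (genericType hM)) a) : IsAlternationBounded L a := by
  intro k φ b
  by_cases h : Holds (genericType hM) φ b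
  · exact Or.inr (encard_not_realize_le hccl ha h)
  · left
    have h' : Holds (genericType hM) φ.not b := by
      rw [holds_genericType_iff]
      refine ((not_holds_genericType_iff hM φ b).1 h).mono fun y hy => not_not.1 hy
    refine (Set.encard_le_encard fun i hi => ?_).trans (encard_not_realize_le hccl ha h')
    exact not_not.2 hi

theorem genericType_eq_limitType (hccl : IsPregeometry (ccl (genericType hM)))
    {a : ℕ → M} (ha : IsFreeSeq (ccl (genericType hM)) a) :
    genericType hM = limitType L a := by
  have : Nonempty M := ⟨a 0⟩
  refine oneType_eq_of_holds fun k φ b h => ?_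
  rw [holds_limitType, ← not_not (a := ∀ᶠ _ in _, _), ← Ultrafilter.eventually_not]
  exact not_eventually_hyperfilter_of_encard_le (encard_not_realize_le hccl ha h)

theorem isBasedOn_of_isFreeSeq (hccl : IsPregeometry (ccl (genericType hM)))
    {a : ℕ → M} (ha : IsFreeSeq (ccl (genericType hM)) a) :
    IsBasedOn (genericType hM) (Set.range a) := by
  refine ⟨?_, fun C hC =>
    ccl_genericType_ne_univ hM ((Set.countable_range a).union hC.countable)⟩
  rw [genericType_eq_limitType hccl ha]
  exact limitType_doesNotSplitOver a subset_rfl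

/-- Over a free sequence, one application of `cl_p` already gives a closed set. -/
theorem clp_clp_of_isFreeSeq (hccl : IsPregeometry (ccl (genericType hM)))
    {a : ℕ → M} (ha : IsFreeSeq (ccl (genericType hM)) a) {X : Set M} (hX : Set.range a ⊆ X) :
    clp (genericType hM) (clp (genericType hM) X) = clp (genericType hM) X := by
  refine Set.Subset.antisymm (fun e he => ?_) (subset_clp_genericType hM _)
  have hb := isAlternationBounded_of_isFreeSeq hccl ha
  have hp := genericType_eq_limitType hccl ha
  have he : ¬ RealizesRestr (genericType hM) (clp (genericType hM) X) e := he
  unfold RealizesRestr at he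
  push Not at he
  obtain ⟨k, φ, c, hc, hφ, hn⟩ := he
  choose S hS hdef hcS using fun i => (mem_clp_genericType hM).1 (hc i)
  rw [hp] at hφ
  obtain ⟨I, hI, hIφ⟩ := exists_subset_of_encard_le (hb.encard_not_le hφ)
  -- Pairs `(x, y)` with `y` in the product of the countable sets `S i`, with `φ(x, y)` false, and
  -- with the vote over `I` certifying `φ(·, y) ∈ p`. The projection to `x` is the countable
  -- `X`-definable set that witnesses `e ∈ cl_p(X)`; definability over `X` uses that `X` contains
  -- the sequence.
  let D : Set (Fin 1 ⊕ Fin k → M) := (⋂ i, {v | v (Sum.inr i) ∈ S i}) ∩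
    ({v | φ.Realize v}ᶜ ∩
      ⋂ i ∈ I, {v | φ.Realize (Sum.elim (fun _ => a i) (fun j => v (Sum.inr j)))})
  have hD : X.Definable L D := by
    refine (Set.definable_iInter_of_finite fun i => ?_).inter (Set.Definable.inter
      (Set.Definable.compl ?_) (Set.definable_biInter_finset (fun i => ?_) _))
    · exact Set.Definable.preimage_comp (fun _ : Fin 1 => (Sum.inr i : Fin 1 ⊕ Fin k)) (hdef i)
    · exact (Set.empty_definable_iff.2 ⟨φ, rfl⟩).mono (Set.empty_subset X)
    · convert definable_realize φ (Sum.elim (fun _ => Sum.inl ⟨a i, hX ⟨i, rfl⟩⟩)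
        (fun j => Sum.inr (Sum.inr j)) : Fin 1 ⊕ Fin k → X ⊕ (Fin 1 ⊕ Fin k)) using 4 with v
      funext x
      cases x <;> rfl
  refine (mem_clp_genericType hM).2 ⟨{x | (fun _ => x) ∈ (fun g : Fin 1 ⊕ Fin k → M =>
    g ∘ Sum.inl) '' D}, ?_, ?_, Sum.elim (fun _ => e) c, ⟨?_, hn, ?_⟩, rfl⟩
  · have hcount : (⋃ y ∈ {y : Fin k → M | (∀ i, y i ∈ S i) ∧ Holds (genericType hM) φ y},
        {x : M | ¬ φ.Realize (Sum.elim (fun _ => x) y)}).Countable := by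
      refine Set.Countable.biUnion ?_ fun y hy => (holds_genericType_iff hM φ y).1 hy.2
      exact (Set.countable_pi hS).mono fun y hy i => hy.1 i
    refine hcount.mono ?_
    rintro x ⟨v, ⟨hv1, hv2, hv3⟩, hvx⟩
    rw [Set.mem_iInter] at hv1
    simp only [Set.mem_iInter] at hv3
    refine Set.mem_biUnion (x := fun j => v (Sum.inr j)) ⟨hv1, ?_⟩ ?_
    · rw [hp]
      refine hb.holds_of_card ?_ hv3
      rw [(Finset.mem_powersetCard.1 hI).2]
      exact k.lt_succ_self
    · have hv : Sum.elim (fun _ => x) (fun j => v (Sum.inr j)) = v := by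
        funext z
        rcases z with z | z
        · exact (congrFun hvx z).symm
        · rfl
      change ¬ φ.Realize _
      rw [hv]
      exact hv2
  · unfold Set.Definable₁
    convert hD.image_comp_sumInl_fin k using 1
    ext v
    have : v = fun _ => v 0 := funext fun z => congrArg v (Subsingleton.elim _ _)
    conv_rhs => rw [this]
    rfl
  · exact Set.mem_iInter.2 hcS
  · simp only [Set.mem_iInter]
    exact hIφ

theorem ccl_eq_clp_of_isFreeSeq (hccl : IsPregeometry (ccl (genericType hM)))
    {a : ℕ → M} (ha : IsFreeSeq (ccl (genericType hM)) a) {X : Set M} (hX : Set.range a ⊆ X) :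
    ccl (genericType hM) X = clp (genericType hM) X := by
  refine Set.Subset.antisymm (Set.iUnion_subset fun n => ?_) (clp_subset_ccl X)
  induction n with
  | zero => exact subset_rfl
  | succ n ih =>
    rw [Function.iterate_succ_apply', ← clp_clp_of_isFreeSeq hccl ha hX]
    exact clp_genericType_mono hM ih

/-- Over the sequence `ccl` equals `cl_p`, so the points outside the closure are exactly the
realizations of `p|(A ∪ B)`, a complete type over `A ∪ B`. -/
theorem isHomogeneousPregeometryOver_of_isFreeSeq
    (hccl : IsPregeometry (ccl (genericType hM))) {a : ℕ → M}
    (ha : IsFreeSeq (ccl (genericType hM)) a) :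
    IsHomogeneousPregeometryOver L (Set.range a)
      (fun X => ccl (genericType hM) (Set.range a ∪ X)) := by
  have hloc := hccl.localize (Set.range a)
  have hne : ∀ B : Set M, B.Finite → ccl (genericType hM) (Set.range a ∪ B) ≠ Set.univ :=
    (isBasedOn_of_isFreeSeq hccl ha).2
  -- The terms of `a` lie in the localized closure of the empty set, so infinite dimension needs a
  -- new free sequence.
  obtain ⟨e, he⟩ := exists_isFreeSeq hne
  refine ⟨hloc, hloc.isInfiniteDimensional he, fun B hB => ?_⟩
  obtain ⟨a₀, ha₀⟩ := (Set.ne_univ_iff_exists_notMem _).1 (hne B hB)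
  refine ⟨a₀, fun x => ?_⟩
  simp only [ccl_eq_clp_of_isFreeSeq hccl ha Set.subset_union_left] at ha₀ ⊢
  have ha₀ : RealizesRestr (genericType hM) (Set.range a ∪ B) a₀ := not_not.1 ha₀
  have hvec : ∀ y : M, ![y] = fun _ => y := fun y => by
    funext i
    rw [Subsingleton.elim i 0]
    rfl
  rw [hvec, hvec]
  constructor
  · intro hx m ψ c hc
    have hx : RealizesRestr (genericType hM) (Set.range a ∪ B) x := not_not.1 hx
    by_cases h : Holds (genericType hM) ψ c
    · exact iff_of_true (hx m ψ c hc h) (ha₀ m ψ c hc h)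
    · have h' : Holds (genericType hM) ψ.not c := by
        rw [holds_genericType_iff]
        exact ((not_holds_genericType_iff hM ψ c).1 h).mono fun y hy => not_not.1 hy
      exact iff_of_false (hx m ψ.not c hc h') (ha₀ m ψ.not c hc h')
  · intro hx hclp
    exact hclp fun m φ c hc h => (hx m φ c hc).2 (ha₀ m φ c hc h)

end Generic

end Quasimin

namespace Quasimin

/-! ### Elementary extensions: existence and uniqueness of the heir. -/

section Heirs

variable {L : FirstOrder.Language.{u, v}} {M N : Type w} [L.Structure M] [L.Structure N]

theorem exists_realize_of_elementary (f : M ↪ₑ[L] N) {α β : Type*} [Finite β]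
    (φ : L.Formula (α ⊕ β)) (v : α → M) {c : β → N} (h : φ.Realize (Sum.elim (f ∘ v) c)) :
    ∃ b : β → M, φ.Realize (Sum.elim v b) := by
  rw [← Formula.realize_iExs (γ := β), ← f.map_formula, Formula.realize_iExs]
  exact ⟨c, h⟩

/-- A violation of the bound involves finitely many terms, so it is an existential statement about
`c` over `M`, and would already occur in `M`. -/
theorem IsAlternationBounded.comp {a : ℕ → M} (h : IsAlternationBounded L a) (f : M ↪ₑ[L] N) :
    IsAlternationBounded L (f ∘ a) := by
  intro k φ c
  by_contra hcon
  rw [not_or, not_le, not_le] at hcon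
  obtain ⟨I, hI, hIc⟩ := Set.exists_subset_encard_eq (Order.add_one_le_of_lt hcon.1)
  obtain ⟨J, hJ, hJc⟩ := Set.exists_subset_encard_eq (Order.add_one_le_of_lt hcon.2)
  have hIf : I.Finite := Set.finite_of_encard_eq_coe (k := k + 1) (by rw [hIc]; norm_cast)
  have hJf : J.Finite := Set.finite_of_encard_eq_coe (k := k + 1) (by rw [hJc]; norm_cast)
  have := hIf.to_subtype
  have := hJf.to_subtype
  let r : ℕ → L.Formula (ℕ ⊕ Fin k) := fun i => φ.relabel (Sum.elim (fun _ => Sum.inl i) Sum.inr)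
  have hr : ∀ {K : Type w} [L.Structure K] (e : ℕ → K) (b : Fin k → K) (i : ℕ),
      (r i).Realize (Sum.elim e b) ↔ φ.Realize (Sum.elim (fun _ => e i) b) := by
    intro K _ e b i
    rw [Formula.realize_relabel]
    refine iff_of_eq (congrArg _ ?_)
    funext x
    cases x <;> rfl
  obtain ⟨b, hb⟩ := exists_realize_of_elementary f
    (Formula.iInf (fun i : I => r i) ⊓ Formula.iInf (fun j : J => (r j).not)) a (c := c) (by
      rw [Formula.realize_inf, Formula.realize_iInf, Formula.realize_iInf]
      exact ⟨fun i => (hr _ _ _).2 (hI i.2), fun j hj => hJ j.2 ((hr _ _ _).1 hj)⟩)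
  rw [Formula.realize_inf, Formula.realize_iInf, Formula.realize_iInf] at hb
  have hlt : (k : ℕ∞) < k + 1 := by exact_mod_cast k.lt_succ_self
  rcases h k φ b with h' | h'
  · have := (Set.encard_le_encard fun i hi => (hr a b i).1 (hb.1 ⟨i, hi⟩)).trans h'
    rw [hIc] at this
    exact hlt.not_ge this
  · have := (Set.encard_le_encard fun i hi hn => hb.2 ⟨i, hi⟩ ((hr a b i).2 hn)).trans h'
    rw [hJc] at this
    exact hlt.not_ge this

theorem realize_relabel_finSum {α : Type*} {k m : ℕ} (φ : L.Formula (α ⊕ (Fin k ⊕ Fin m)))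
    (v : α → N) (c : Fin k ⊕ Fin m → N) :
    (φ.relabel (Sum.map id finSumFinEquiv)).Realize (Sum.elim v (c ∘ finSumFinEquiv.symm)) ↔
      φ.Realize (Sum.elim v c) := by
  rw [Formula.realize_relabel]
  refine iff_of_eq (congrArg _ ?_)
  funext x
  rcases x with x | x
  · rfl
  · simp

theorem infinite_of_eventually_hyperfilter {P : ℕ → Prop}
    (h : ∀ᶠ i in Filter.hyperfilter ℕ, P i) : {i | P i}.Infinite :=
  fun hf => Filter.notMem_hyperfilter_of_finite hf h

theorem isHeir_limitType {a : ℕ → M} (h : IsAlternationBounded L a) (f : M ↪ₑ[L] N) :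
    IsHeir f (limitType L a) (limitType L (f ∘ a)) := by
  constructor
  · intro k φ b hb
    rw [holds_limitType] at hb ⊢
    refine hb.mono fun i hi => ?_
    rw [← f.map_formula] at hi
    convert hi using 1
    funext x
    cases x <;> rfl
  · intro k m φ c d hq
    rw [holds_limitType] at hq
    -- `φ` has `k + m` parameters, so `k + m + 1` instances, pulled down to a tuple `b` of `M`,
    -- force `φ(x, b, d)` into the limit type.
    obtain ⟨I, hI, hIc⟩ := (infinite_of_eventually_hyperfilter hq).exists_subset_card_eq (k + m + 1)
    let r : ℕ → L.Formula ((ℕ ⊕ Fin m) ⊕ Fin k) := fun i => φ.relabel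
      (Sum.elim (fun _ => Sum.inl (Sum.inl i)) (Sum.elim Sum.inr (fun j => Sum.inl (Sum.inr j))))
    have hr : ∀ {K : Type w} [L.Structure K] (e : ℕ → K) (b : Fin k → K) (d : Fin m → K) (i : ℕ),
        (r i).Realize (Sum.elim (Sum.elim e d) b) ↔
          φ.Realize (Sum.elim (fun _ => e i) (Sum.elim b d)) := by
      intro K _ e b d i
      rw [Formula.realize_relabel]
      refine iff_of_eq (congrArg _ ?_)
      funext x
      rcases x with x | x | x <;> rfl
    obtain ⟨b, hb⟩ := exists_realize_of_elementary f (Formula.iInf (fun i : I => r i))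
      (Sum.elim a d) (c := c) (by
        rw [Formula.realize_iInf, Sum.comp_elim]
        exact fun i => (hr _ _ _ _).2 (hI i.2))
    rw [Formula.realize_iInf] at hb
    refine ⟨b, ?_⟩
    have key := h.holds_of_card (φ := φ.relabel (Sum.map id finSumFinEquiv))
      (c := Sum.elim b d ∘ finSumFinEquiv.symm) (I := I) (by omega)
      (fun i hi => (realize_relabel_finSum _ _ _).2 ((hr _ _ _ _).1 (hb ⟨i, hi⟩)))
    simpa only [holds_limitType, realize_relabel_finSum] using key

/-- If `φ(x, c) ∈ q` failed in the limit, it would be false at `k + 1` terms. The heir property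
moves `φ(x, c)` together with these failures to some `b` in `M`; then `φ(x, b)` is in the limit type
although `k + 1` failures exclude it. -/
theorem IsHeir.eq_limitType {a : ℕ → M} (h : IsAlternationBounded L a) {f : M ↪ₑ[L] N}
    {q : OneType L N} (hq : IsHeir f (limitType L a) q) : q = limitType L (f ∘ a) := by
  have : Nonempty N := ⟨f (a 0)⟩
  refine oneType_eq_of_holds fun k φ c hφ => ?_
  by_contra hn
  rw [holds_limitType, ← Ultrafilter.eventually_not] at hn
  let e := (infinite_of_eventually_hyperfilter hn).natEmbedding
  let ψ : L.Formula (Fin 1 ⊕ (Fin k ⊕ Fin (k + 1))) := φ.relabel (Sum.map id Sum.inl) ⊓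
    Formula.iInf fun j : Fin (k + 1) => (φ.relabel (Sum.elim (fun _ => Sum.inr (Sum.inr j))
      (fun i => Sum.inr (Sum.inl i)))).not
  have hψ : ∀ {K : Type w} [L.Structure K] (x : Fin 1 → K) (b : Fin k → K) (d : Fin (k + 1) → K),
      ψ.Realize (Sum.elim x (Sum.elim b d)) ↔
        φ.Realize (Sum.elim x b) ∧ ∀ j, ¬ φ.Realize (Sum.elim (fun _ => d j) b) := by
    intro K _ x b d
    rw [Formula.realize_inf, Formula.realize_iInf]
    simp only [Formula.realize_not, Formula.realize_relabel]
    refine and_congr (iff_of_eq (congrArg _ ?_))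
      (forall_congr' fun j => not_congr (iff_of_eq (congrArg _ ?_)))
    · funext x
      cases x <;> rfl
    · funext x
      cases x <;> rfl
  obtain ⟨b, hb⟩ := hq.2 k (k + 1) ψ c (fun j => a (e j)) (by
    refine mem_of_realize_imp (fun x hx => ?_) hφ
    rw [realize_inst] at hx ⊢
    exact (hψ _ _ _).2 ⟨hx, fun j => (e j).2⟩)
  rw [holds_limitType] at hb
  simp only [hψ] at hb
  have h1 : Holds (limitType L a) φ.not b := by
    refine h.holds_of_card
      (I := Finset.univ.map ⟨fun j : Fin (k + 1) => (e j : ℕ), fun i j hij => ?_⟩) ?_ ?_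
    · exact Fin.ext (e.injective (Subtype.ext hij))
    · simp
    · intro i hi
      obtain ⟨j, -, rfl⟩ := Finset.mem_map.1 hi
      obtain ⟨_, hx⟩ := hb.exists
      exact hx.2 j
  rw [holds_limitType] at h1
  obtain ⟨i, h2, h3⟩ := (h1.and hb).exists
  exact h2 h3.1

end Heirs

/-! ### Iterated limits and symmetry. -/

section Iterates

variable {L : FirstOrder.Language.{u, v}} {N : Type w} [L.Structure N]

/-- The iterated limit of a sequence along a fixed nonprincipal ultrafilter, as an ultrafilter of
tuples. -/
noncomputable def iterLimit (a : ℕ → N) : (n : ℕ) → Ultrafilter (Fin n → N)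
  | 0 => pure Fin.elim0
  | n + 1 => (Filter.hyperfilter ℕ).bind fun i =>
      (iterLimit a n).map fun x => (Fin.snoc x (a i) : Fin (n + 1) → N)

theorem eventually_iterLimit_succ (a : ℕ → N) {n : ℕ} {R : (Fin (n + 1) → N) → Prop} :
    (∀ᶠ x in iterLimit a (n + 1), R x) ↔ ∀ᶠ i in Filter.hyperfilter ℕ,
      ∀ᶠ x in iterLimit a n, R (Fin.snoc x (a i) : Fin (n + 1) → N) :=
  Iff.rfl

theorem realize_lastVar {n k : ℕ} (φ : L.Formula (Fin (n + 1) ⊕ Fin k)) (x : Fin n → N) (y : N)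
    (c : Fin k → N) :
    (lastVar φ).Realize (Sum.elim (fun _ => y) (Sum.elim x c)) ↔
      φ.Realize (Sum.elim (Fin.snoc x y : Fin (n + 1) → N) c) := by
  unfold lastVar
  rw [Formula.realize_relabel]
  refine iff_of_eq (congrArg _ ?_)
  funext i
  rcases i with i | i
  · refine Fin.lastCases ?_ (fun j => ?_) i <;> simp
  · rfl

/-- Turn the last variable of a formula into a parameter. -/
def lastVarToParam {n k : ℕ} (φ : L.Formula (Fin (n + 1) ⊕ Fin k)) :
    L.Formula (Fin n ⊕ Fin (k + 1)) :=
  φ.relabel (Sum.elim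
    (Fin.lastCases (motive := fun _ => Fin n ⊕ Fin (k + 1)) (Sum.inr (Fin.last k)) Sum.inl)
    (fun j => Sum.inr j.castSucc))

theorem realize_lastVarToParam {n k : ℕ} (φ : L.Formula (Fin (n + 1) ⊕ Fin k)) (x : Fin n → N)
    (y : N) (c : Fin k → N) :
    (lastVarToParam φ).Realize (Sum.elim x (Fin.snoc c y : Fin (k + 1) → N)) ↔
      φ.Realize (Sum.elim (Fin.snoc x y : Fin (n + 1) → N) c) := by
  unfold lastVarToParam
  rw [Formula.realize_relabel]
  refine iff_of_eq (congrArg _ ?_)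
  funext i
  rcases i with i | i
  · refine Fin.lastCases ?_ (fun j => ?_) i <;> simp
  · simp

theorem IsSaturated.exists_realizesRestr {κ : Cardinal.{w}} (hN : IsSaturated L κ N) (a : ℕ → N)
    {S : Set N} (hS : #S < κ) : ∃ e, RealizesRestr (limitType L a) S e := by
  obtain ⟨e, he⟩ := hN S hS
    {φ | ∀ᶠ i in Filter.hyperfilter ℕ, φ.Realize (fun _ => a i)} (by
      intro Γ₀ hΓ₀ hfin
      obtain ⟨i, hi⟩ := ((Filter.eventually_all_finite hfin).2 fun φ hφ => hΓ₀ hφ).exists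
      exact ⟨a i, hi⟩)
  refine ⟨e, fun m φ c hc hφ => ?_⟩
  rw [holds_limitType] at hφ
  have hdef := definable_realize φ
      (Sum.elim Sum.inr (fun i => Sum.inl ⟨c i, hc i⟩) : Fin 1 ⊕ Fin m → S ⊕ Fin 1)
  obtain ⟨ψ, hψ⟩ := hdef
  have key : ∀ y : N, ψ.Realize (fun _ => y) ↔ φ.Realize (Sum.elim (fun _ => y) c) := by
    intro y
    refine (Set.ext_iff.1 hψ (fun _ => y)).symm.trans (iff_of_eq ?_)
    refine congrArg φ.Realize (a₁ := fun b => Sum.elim (fun x : S => (x : N)) (fun _ => y)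
      (Sum.elim Sum.inr (fun i => Sum.inl ⟨c i, hc i⟩) b)) ?_
    funext x
    cases x <;> rfl
  exact (key e).1 (he ψ (hφ.mono fun i hi => (key _).2 hi))

theorem IsSaturated.exists_realizes_iterLimit {κ : Cardinal.{w}} (hN : IsSaturated L κ N)
    (hκ : ℵ₀ < κ) (a : ℕ → N) (n : ℕ) : ∀ S : Set N, #S < κ → ∃ x : Fin n → N,
      ∀ (m : ℕ) (ψ : L.Formula (Fin n ⊕ Fin m)) (d : Fin m → N), (∀ i, d i ∈ S) →
        (∀ᶠ y in iterLimit a n, ψ.Realize (Sum.elim y d)) → ψ.Realize (Sum.elim x d) := by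
  induction n with
  | zero => exact fun S _ => ⟨Fin.elim0, fun m ψ d _ h => h⟩
  | succ n ih =>
    intro S hS
    have hadd : ∀ (T : Set N), T.Countable → #(S ∪ T : Set N) < κ := fun T hT =>
      (mk_union_le S T).trans_lt (add_lt_of_lt hκ.le hS ((le_aleph0_iff_set_countable.2 hT).trans_lt hκ))
    -- The terms of `a` are included because the outer limit evaluates the last variable at `a i`,
    -- making it a parameter of the formula about `x`.
    obtain ⟨x, hx⟩ := ih (S ∪ Set.range a) (hadd _ (Set.countable_range a))
    obtain ⟨e, he⟩ := hN.exists_realizesRestr a (hadd (Set.range x) (Set.countable_range x))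
    refine ⟨Fin.snoc x e, fun m ψ d hd hψ => ?_⟩
    rw [eventually_iterLimit_succ] at hψ
    rw [← realize_lastVar, ← realize_relabel_finSum]
    refine he _ _ _ (fun i => ?_) ?_
    · rcases h : finSumFinEquiv.symm i with j | j
      · exact Or.inr ⟨j, by simp [h]⟩
      · exact Or.inl (by simpa [h] using hd j)
    · rw [holds_limitType]
      refine hψ.mono fun i hi => ?_
      rw [realize_relabel_finSum, realize_lastVar, ← realize_lastVarToParam]
      refine hx _ _ _ (fun j => ?_) (by simpa only [realize_lastVarToParam] using hi)
      refine Fin.lastCases ?_ (fun j => ?_) j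
      · exact Or.inr ⟨i, by simp⟩
      · exact Or.inl (by simpa using hd j)

/-- A realization `x` of the `n`-th iterate over `a` and `c` decides `φ(x, a i, c)` as the inner
limit does, for every `i`; saturation supplies such an `x`. -/
theorem iter_limitType_iff {κ : Cardinal.{w}} (hN : IsSaturated L κ N) (hκ : ℵ₀ < κ)
    (a : ℕ → N) (n : ℕ) : ∀ {k : ℕ} (φ : L.Formula (Fin n ⊕ Fin k)) (c : Fin k → N),
      Iter (limitType L a) (Set.range a) n φ c ↔
        ∀ᶠ x in iterLimit a n, φ.Realize (Sum.elim x c) := by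
  induction n with
  | zero =>
    intro k φ c
    exact Iff.rfl
  | succ n ih =>
    intro k φ c
    have key : ∀ x : Fin n → N, (∀ (m : ℕ) (ψ : L.Formula (Fin n ⊕ Fin m)) (d : Fin m → N),
        (∀ i, d i ∈ Set.range a ∪ Set.range c) →
          (∀ᶠ y in iterLimit a n, ψ.Realize (Sum.elim y d)) → ψ.Realize (Sum.elim x d)) →
        (Holds (limitType L a) (lastVar φ) (Sum.elim x c) ↔
          ∀ᶠ x in iterLimit a (n + 1), φ.Realize (Sum.elim x c)) := by
      intro x hx
      rw [holds_limitType, eventually_iterLimit_succ]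
      refine Filter.eventually_congr (Filter.Eventually.of_forall fun i => ?_)
      have hd : ∀ j, (Fin.snoc c (a i) : Fin (k + 1) → N) j ∈ Set.range a ∪ Set.range c := by
        intro j
        refine Fin.lastCases ?_ (fun j => ?_) j
        · exact Or.inl ⟨i, by simp⟩
        · exact Or.inr ⟨j, by simp⟩
      have h1 := hx _ (lastVarToParam φ) _ hd
      have h2 := hx _ (lastVarToParam φ).not _ hd
      simp only [Formula.realize_not, realize_lastVarToParam] at h1 h2
      rw [Ultrafilter.eventually_not] at h2
      rw [realize_lastVar]
      exact ⟨fun h => by_contra fun hn => h2 hn h, h1⟩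
    constructor
    · rintro ⟨x, hx, hφ⟩
      refine (key x fun m ψ d hd hψ => ?_).1 hφ
      exact hx m ψ d hd ((ih ψ d).2 hψ)
    · intro hφ
      obtain ⟨x, hx⟩ := hN.exists_realizes_iterLimit hκ a n (Set.range a ∪ Set.range c)
        ((le_aleph0_iff_set_countable.2 ((Set.countable_range a).union (Set.countable_range c))).trans_lt hκ)
      refine ⟨x, fun m ψ d hd hψ => hx m ψ d hd ((ih ψ d).1 hψ), (key x hx).2 hφ⟩

/-- The tuples of indices from `J` along which a formula fails. -/
noncomputable def failures (a : ℕ → N) (J : Finset ℕ) {n k : ℕ} (φ : L.Formula (Fin n ⊕ Fin k))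
    (c : Fin k → N) : Finset (Fin n → ℕ) :=
  open Classical in
  (Fintype.piFinset fun _ : Fin n => J).filter fun x => ¬ φ.Realize (Sum.elim (a ∘ x) c)

theorem mem_failures {a : ℕ → N} {J : Finset ℕ} {n k : ℕ} {φ : L.Formula (Fin n ⊕ Fin k)}
    {c : Fin k → N} {x : Fin n → ℕ} :
    x ∈ failures a J φ c ↔ (∀ i, x i ∈ J) ∧ ¬ φ.Realize (Sum.elim (a ∘ x) c) := by
  simp [failures]

/-- One tuple `x` can be generic enough for finitely many indices at once. With `x` and `c` as `n +
k` parameters, `φ` holds at `n + k + 1` good indices, so it fails at no more than `n + k` bad ones.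
-/
theorem IsAlternationBounded.card_not_eventually_le {a : ℕ → N} (h : IsAlternationBounded L a)
    {n k : ℕ} {φ : L.Formula (Fin (n + 1) ⊕ Fin k)} {c : Fin k → N}
    (hφ : ∀ᶠ x in iterLimit a (n + 1), φ.Realize (Sum.elim x c)) {J : Finset ℕ}
    (hJ : ∀ i ∈ J, ¬ ∀ᶠ x in iterLimit a n,
      φ.Realize (Sum.elim (Fin.snoc x (a i) : Fin (n + 1) → N) c)) : J.card ≤ n + k := by
  rw [eventually_iterLimit_succ] at hφ
  obtain ⟨I, hI, hIc⟩ := (infinite_of_eventually_hyperfilter hφ).exists_subset_card_eq (n + k + 1)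
  have h1 := (Filter.eventually_all_finset I).2 fun i hi => hI hi
  have h2 := (Filter.eventually_all_finset J).2 fun i hi =>
    Ultrafilter.eventually_not.2 (hJ i hi)
  obtain ⟨x, hx1, hx2⟩ := (h1.and h2).exists
  have hr : ∀ i, ((lastVar φ).relabel (Sum.map id finSumFinEquiv)).Realize
      (Sum.elim (fun _ => a i) (Sum.elim x c ∘ finSumFinEquiv.symm)) ↔
        φ.Realize (Sum.elim (Fin.snoc x (a i) : Fin (n + 1) → N) c) := fun i => by
    rw [realize_relabel_finSum, realize_lastVar]
  rcases h _ ((lastVar φ).relabel (Sum.map id finSumFinEquiv))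
    (Sum.elim x c ∘ finSumFinEquiv.symm) with h' | h'
  · have := (Set.encard_le_encard (s := (I : Set ℕ)) fun i hi => (hr i).2 (hx1 i hi)).trans h'
    rw [Set.encard_coe_eq_coe_finsetCard] at this
    have : I.card ≤ n + k := by exact_mod_cast this
    omega
  · have := (Set.encard_le_encard (s := (J : Set ℕ))
      fun i hi hn => hx2 i hi ((hr i).1 hn)).trans h'
    rw [Set.encard_coe_eq_coe_finsetCard] at this
    exact_mod_cast this

/-- Fibre the failures over the last coordinate. At most `K` bad values contribute up to `|J|^n`
each; over a good value, induction applies with `a i` as a new parameter. The sum `n + k` is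
unchanged by that move, so one `K` serves throughout. The factor `J.card` on the left avoids the
exponent `n - 1`. -/
theorem IsAlternationBounded.card_failures_le {a : ℕ → N} (h : IsAlternationBounded L a)
    (J : Finset ℕ) (K n : ℕ) : ∀ {k : ℕ} (φ : L.Formula (Fin n ⊕ Fin k)) (c : Fin k → N),
      n + k ≤ K → (∀ᶠ x in iterLimit a n, φ.Realize (Sum.elim x c)) →
        (failures a J φ c).card * J.card ≤ n * K * J.card ^ n := by
  classical
  induction n with
  | zero =>
    intro k φ c _ hφ
    have : failures a J φ c = ∅ := by
      rw [Finset.eq_empty_iff_forall_notMem]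
      intro x hx
      refine (mem_failures.1 hx).2 ?_
      have hφ : φ.Realize (Sum.elim Fin.elim0 c) := hφ
      convert hφ
    simp [this]
  | succ n ih =>
    intro k φ c hK hφ
    let B : ℕ → Prop := fun i => ∀ᶠ x in iterLimit a n,
      φ.Realize (Sum.elim (Fin.snoc x (a i) : Fin (n + 1) → N) c)
    let F : ℕ → Finset (Fin n → ℕ) := fun i =>
      failures a J (lastVarToParam φ) (Fin.snoc c (a i) : Fin (k + 1) → N)
    have hfib : (failures a J φ c).card ≤ ∑ i ∈ J, (F i).card := by
      rw [Finset.card_eq_sum_card_fiberwise (f := fun x => x (Fin.last n)) (t := J)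
        fun x hx => (mem_failures.1 hx).1 _]
      refine Finset.sum_le_sum fun i _ => ?_
      refine Finset.card_le_card_of_injOn (fun x => (Fin.init x : Fin n → ℕ)) ?_ ?_
      · intro x hx
        obtain ⟨hxf, rfl⟩ := Finset.mem_filter.1 hx
        obtain ⟨hxJ, hxφ⟩ := mem_failures.1 hxf
        refine mem_failures.2 ⟨fun j => hxJ _, ?_⟩
        rw [realize_lastVarToParam]
        convert hxφ using 4
        funext j
        refine Fin.lastCases ?_ (fun j => ?_) j <;> simp [Fin.init]
      · intro x hx y hy hxy
        have hx := (Finset.mem_filter.1 hx).2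
        have hy := (Finset.mem_filter.1 hy).2
        rw [← Fin.snoc_init_self x, ← Fin.snoc_init_self y, hx, hy]
        exact congrArg (fun z : Fin n → ℕ => (Fin.snoc z i : Fin (n + 1) → ℕ)) hxy
    have hbound : ∀ i ∈ J, (F i).card * J.card ≤
        (if ¬ B i then J.card ^ (n + 1) else 0) + n * K * J.card ^ n := by
      intro i _
      by_cases hB : B i
      · rw [if_neg (not_not.2 hB), zero_add]
        refine ih _ _ (by omega) ?_
        simpa only [realize_lastVarToParam] using hB
      · rw [if_pos hB, pow_succ]
        refine le_add_right (Nat.mul_le_mul_right _ ?_)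
        calc (F i).card ≤ (Fintype.piFinset fun _ : Fin n => J).card :=
              Finset.card_filter_le _ _
          _ = J.card ^ n := by simp
    have hbad : (J.filter fun i => ¬ B i).card ≤ K := by
      refine (h.card_not_eventually_le hφ fun i hi => (Finset.mem_filter.1 hi).2).trans ?_
      omega
    calc (failures a J φ c).card * J.card ≤ ∑ i ∈ J, (F i).card * J.card := by
          rw [← Finset.sum_mul]
          exact Nat.mul_le_mul_right _ hfib
      _ ≤ ∑ i ∈ J, ((if ¬ B i then J.card ^ (n + 1) else 0) + n * K * J.card ^ n) :=
          Finset.sum_le_sum hbound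
      _ = (J.filter fun i => ¬ B i).card * J.card ^ (n + 1) + J.card * (n * K * J.card ^ n) := by
          rw [Finset.sum_add_distrib, ← Finset.sum_filter, Finset.sum_const, Finset.sum_const,
            smul_eq_mul, smul_eq_mul]
      _ ≤ K * J.card ^ (n + 1) + J.card * (n * K * J.card ^ n) :=
          Nat.add_le_add_right (Nat.mul_le_mul_right _ hbad) _
      _ = (n + 1) * K * J.card ^ (n + 1) := by ring

theorem realize_relabel_perm {n k : ℕ} (φ : L.Formula (Fin n ⊕ Fin k)) (π : Equiv.Perm (Fin n))
    (x : Fin n → N) (c : Fin k → N) :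
    (φ.relabel (Sum.map π id)).Realize (Sum.elim x c) ↔ φ.Realize (Sum.elim (x ∘ π) c) := by
  rw [Formula.realize_relabel]
  refine iff_of_eq (congrArg _ ?_)
  funext i
  cases i <;> rfl

/-- Otherwise `φ` and the negation of its permuted form both hold in the limit. Each tuple of `J^n`
is a failure of the first or, after permutation, of the second, but both failure sets are too small
to cover `J^n`. -/
theorem IsAlternationBounded.eventually_iterLimit_perm {a : ℕ → N}
    (h : IsAlternationBounded L a) {n k : ℕ} (φ : L.Formula (Fin n ⊕ Fin k)) (c : Fin k → N)
    (π : Equiv.Perm (Fin n)) (hφ : ∀ᶠ x in iterLimit a n, φ.Realize (Sum.elim x c)) :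
    ∀ᶠ x in iterLimit a n, (φ.relabel (Sum.map π id)).Realize (Sum.elim x c) := by
  by_contra hn
  rw [← Ultrafilter.eventually_not] at hn
  let K := n + k
  -- One more than the two failure bounds `n * K` combined.
  let J := Finset.range (2 * (n * K) + 1)
  have hJ : J.card = 2 * (n * K) + 1 := Finset.card_range _
  have h1 := h.card_failures_le J K n φ c le_rfl hφ
  have h2 := h.card_failures_le J K n (φ.relabel (Sum.map π id)).not c le_rfl hn
  have hsum : J.card ^ n ≤
      (failures a J φ c).card + (failures a J (φ.relabel (Sum.map π id)).not c).card := by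
    classical
    have hsub : (Fintype.piFinset fun _ : Fin n => J) ⊆ failures a J φ c ∪
        (failures a J (φ.relabel (Sum.map π id)).not c).image (fun x => x ∘ π) := by
      intro x hx
      rw [Fintype.mem_piFinset] at hx
      by_cases hr : φ.Realize (Sum.elim (a ∘ x) c)
      · refine Finset.mem_union_right _ (Finset.mem_image.2 ⟨x ∘ π.symm, ?_, ?_⟩)
        · refine mem_failures.2 ⟨fun i => hx _, ?_⟩
          rw [Formula.realize_not, not_not, realize_relabel_perm]
          convert hr using 2
          funext i
          simp
        · funext i
          simp
      · exact Finset.mem_union_left _ (mem_failures.2 ⟨hx, hr⟩)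
    calc J.card ^ n = (Fintype.piFinset fun _ : Fin n => J).card := by simp
      _ ≤ _ := (Finset.card_le_card hsub).trans
          ((Finset.card_union_le _ _).trans (Nat.add_le_add_left Finset.card_image_le _))
  have hpos : 0 < J.card ^ n := by
    rw [hJ]
    positivity
  have : J.card * J.card ^ n ≤ (2 * (n * K)) * J.card ^ n := by
    calc J.card * J.card ^ n ≤ J.card * ((failures a J φ c).card +
          (failures a J (φ.relabel (Sum.map π id)).not c).card) := Nat.mul_le_mul_left _ hsum
      _ = (failures a J φ c).card * J.card +
          (failures a J (φ.relabel (Sum.map π id)).not c).card * J.card := by ring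
      _ ≤ n * K * J.card ^ n + n * K * J.card ^ n := Nat.add_le_add h1 h2
      _ = _ := by ring
  have := Nat.le_of_mul_le_mul_right this hpos
  omega

theorem IsAlternationBounded.isSymmetric {a : ℕ → N} (h : IsAlternationBounded L a)
    {κ : Cardinal.{w}} (hN : IsSaturated L κ N) (hκ : ℵ₀ < κ) :
    IsSymmetric κ (limitType L a) := by
  refine ⟨Set.range a, (le_aleph0_iff_set_countable.2 (Set.countable_range a)).trans_lt hκ,
    limitType_doesNotSplitOver a subset_rfl, fun n k φ c π => ?_⟩
  rw [iter_limitType_iff hN hκ, iter_limitType_iff hN hκ]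
  refine ⟨h.eventually_iterLimit_perm φ c π, fun hφ => ?_⟩
  by_contra hn
  rw [← Ultrafilter.eventually_not] at hn
  -- The converse is the forward direction for the negation, the limit being an ultrafilter.
  have := h.eventually_iterLimit_perm φ.not c π hn
  obtain ⟨x, hx1, hx2⟩ := (hφ.and this).exists
  exact hx2 hx1

end Iterates

end Quasimin

/-! ### The main theorem. -/

theorem corollary7p8 {L : FirstOrder.Language.{u, v}} {M : Type w} [L.Structure M]
    (hM : Quasimin.IsQuasiminimal L M)
    (hccl : Quasimin.IsPregeometry (Quasimin.ccl (Quasimin.genericType hM))) :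
    -- the generic type is definable and countably based
    Quasimin.IsDefinableType (Quasimin.genericType hM) ∧
    Quasimin.IsCountablyBased (Quasimin.genericType hM) ∧
    -- it is symmetric: its heir over any monster model is
    (∀ (κ : Cardinal.{w}) (N : Type w) [L.Structure N] (f : M ↪ₑ[L] N),
      Cardinal.mk M < κ → Quasimin.IsSaturated L κ N →
        (∃! q : Quasimin.OneType L N, Quasimin.IsHeir f (Quasimin.genericType hM) q) ∧
        ∀ q : Quasimin.OneType L N, Quasimin.IsHeir f (Quasimin.genericType hM) q →
          Quasimin.IsSymmetric κ q) ∧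
    -- a base is given by an infinite countable `ccl`-free sequence, over which `ccl` is homogeneous
    (∃ a : ℕ → M, Quasimin.IsFreeSeq (Quasimin.ccl (Quasimin.genericType hM)) a ∧
      Quasimin.IsBasedOn (Quasimin.genericType hM) (Set.range a) ∧
      Quasimin.IsHomogeneousPregeometryOver L (Set.range a)
        (fun X => Quasimin.ccl (Quasimin.genericType hM) (Set.range a ∪ X))) := by
  obtain ⟨a, ha⟩ := Quasimin.exists_isFreeSeq
    (cl := Quasimin.ccl (Quasimin.genericType hM))
    fun X hX => Quasimin.ccl_genericType_ne_univ hM hX.countable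
  have hbased := Quasimin.isBasedOn_of_isFreeSeq hccl ha
  have hb := Quasimin.isAlternationBounded_of_isFreeSeq hccl ha
  refine ⟨?_, ⟨_, Set.countable_range a, hbased⟩, ?_, a, ha, hbased,
    Quasimin.isHomogeneousPregeometryOver_of_isFreeSeq hccl ha⟩
  · rw [Quasimin.genericType_eq_limitType hccl ha]
    exact hb.isDefinableType
  · intro κ N _ f hκ hN
    have := hM.uncountable
    have hκ' : ℵ₀ < κ := (aleph0_le_mk M).trans_lt hκ
    rw [Quasimin.genericType_eq_limitType hccl ha]
    refine ⟨⟨_, Quasimin.isHeir_limitType hb f, fun q hq => hq.eq_limitType hb⟩, fun q hq => ?_⟩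
    rw [hq.eq_limitType hb]
    exact (hb.comp f).isSymmetric hN hκ'
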